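/- **Theorem (closed form solution of the time scale dynamic Lyapunov equation).** Let $\mathbb{T}\subseteq\mathbb{R}$ be a time scale, i.e. a nonempty closed set. Put $\sigma(t)=\inf\{s\in\mathbb{T}: s>t\}$ and $\rho(t)=\sup\{s\in\mathbb{T}: s<t\}$ (with $\sigma(\max\mathbb{T})=\max\mathbb{T}$ and $\rho(\min\mathbb{T})=\min\mathbb{T}$ when these exist), let $\mu(t)=\sigma(t)-t$, and let $\mathbb{T}^\kappa$ be $\mathbb{T}$ without its maximum $m$ if $m$ exists and $\rho(m)<m$, and $\mathbb{T}^\kappa=\mathbb{T}$ otherwise. A function $f:\mathbb{T}\to\mathbb{R}$ has delta derivative $f^\Delta(t)$ at $t\in\mathbb{T}^\kappa$ if for every $\varepsilon>0$ there is a neighbourhood $U$ of $t$ in $\mathbb{T}$ with $|f(\sigma(t))-f(s)-f^\Delta(t)(\sigma(t)-s)|\le\varepsilon|\sigma(t)-s|$ for all $s\in U$. It is rd-continuous if it is continuous at every $t$ with $\sigma(t)=t$ and has a finite left-sided limit at every $t$ with $\rho(t)=t$ (no condition if $t=\min\mathbb{T}$). The integral $\int_a^b f(s)\,\Delta s$ is,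 for $a\le b$ in $\mathbb{T}$, the Lebesgue integral of $f$ over $[a,b)\cap\mathbb{T}$ with respect to the measure on $\mathbb{T}$ that is the sum of Lebesgue measure restricted to $\mathbb{T}$ and of a point mass $\mu(t)$ at each $t\in\mathbb{T}$ with $\sigma(t)>t$; and $\int_a^b=-\int_b^a$ for $b<a$. For matrix-valued functions all these notions are understood entrywise. Let $A,M:\mathbb{T}\to\mathbb{R}^{n\times n}$ be rd-continuous, let $A$ be regressive, i.e. $I+\mu(t)A(t)$ is invertible for all $t\in\mathbb{T}^\kappa$, and let $t_0\in\mathbb{T}$ and $P_0\in\mathbb{R}^{n\times n}$. Then the initial value problem $X^\Delta(t)=A(t)X(t)$ $(t\in\mathbb{T}^\kappa)$, $X(t_0)=I$, has a unique solution $X:\mathbb{T}\to\mathbb{R}^{n\times n}$, the transition matrix $\Phi_A(\cdot,t_0)$. The matrix $\Phi_A(t,t_0)$ is invertible for every $t\in\mathbb{T}$, and $s\mapsto\Phi_A^T(s,t_0)M(s)\Phi_A(s,t_0)$ is integrable on every bounded interval $[a,b)\cap\mathbb{T}$ with $a,b\in\mathbb{T}$. Moreover, among all functions $P:\mathbb{T}\to\mathbb{R}^{n\times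 n}$ that are delta differentiable on $\mathbb{T}^\kappa$, the problem $$A^T(t)P(t)+P(t)A(t)+\mu(t)A^T(t)P(t)A(t)+(I+\mu(t)A^T(t))\,P^\Delta(t)\,(I+\mu(t)A(t))=-M(t)\quad(t\in\mathbb{T}^\kappa),\qquad P(t_0)=P_0,$$ has exactly one solution, and it is given for all $t\in\mathbb{T}$ by $$P(t)=(\Phi_A^T(t,t_0))^{-1}\left[P_0-\int_{t_0}^t\Phi_A^T(s,t_0)M(s)\Phi_A(s,t_0)\,\Delta s\right](\Phi_A(t,t_0))^{-1}.$$ (If $\mathbb{T}$ is a single point, every number is a delta derivative there, and the equation is read as: it holds for some value of $P^\Delta(t_0)$.) -/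

import Mathlib

open Filter Topology MeasureTheory

noncomputable section

/-- A time scale: a nonempty closed subset of the real line. -/
structure TimeScale where
  carrier : Set ℝ
  isClosed : IsClosed carrier
  nonempty : carrier.Nonempty

namespace TimeScale

instance : CoeSort TimeScale Type := ⟨fun T => T.carrier⟩

variable {T : TimeScale} {n : ℕ}

theorem sInf_Ioi_mem (t : T) (h : ∃ s : T, t < s) :
    sInf (T.carrier ∩ Set.Ioi (t : ℝ)) ∈ T.carrier := by
  have hne : (T.carrier ∩ Set.Ioi (t : ℝ)).Nonempty := by
    obtain ⟨s, hs⟩ := h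
    exact ⟨s, s.2, hs⟩
  have hb : BddBelow (T.carrier ∩ Set.Ioi (t : ℝ)) := ⟨t, fun x hx => le_of_lt hx.2⟩
  have h1 := csInf_mem_closure hne hb
  exact T.isClosed.closure_subset (closure_mono Set.inter_subset_left h1)

theorem sSup_Iio_mem (t : T) (h : ∃ s : T, s < t) :
    sSup (T.carrier ∩ Set.Iio (t : ℝ)) ∈ T.carrier := by
  have hne : (T.carrier ∩ Set.Iio (t : ℝ)).Nonempty := by
    obtain ⟨s, hs⟩ := h
    exact ⟨s, s.2, hs⟩
  have hb : BddAbove (T.carrier ∩ Set.Iio (t : ℝ)) := ⟨t, fun x hx => le_of_lt hx.2⟩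
  have h1 := csSup_mem_closure hne hb
  exact T.isClosed.closure_subset (closure_mono Set.inter_subset_left h1)

open Classical in
/-- The forward jump operator `σ(t) = inf {s ∈ T | s > t}`, with the usual convention
`inf ∅ = sup T`, so that `σ(t) = t` when `t` is the maximum of `T`. -/
def sigma (t : T) : T :=
  if h : ∃ s : T, t < s then ⟨sInf (T.carrier ∩ Set.Ioi (t : ℝ)), sInf_Ioi_mem t h⟩ else t

open Classical in
/-- The backward jump operator `ρ(t) = sup {s ∈ T | s < t}`, with the usual convention
`sup ∅ = inf T`, so that `ρ(t) = t` when `t` is the minimum of `T`. -/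
def rho (t : T) : T :=
  if h : ∃ s : T, s < t then ⟨sSup (T.carrier ∩ Set.Iio (t : ℝ)), sSup_Iio_mem t h⟩ else t

/-- The graininess `μ(t) = σ(t) - t`. -/
def graininess (t : T) : ℝ := (sigma t : ℝ) - t

/-- The set `T^κ`: the time scale `T` without its maximum, if that maximum exists and is
left-scattered. -/
def kappa (T : TimeScale) : Set T := {t | ¬ ((∀ s : T, s ≤ t) ∧ rho t < t)}

/-- `f : T → ℝ` has delta (Hilger) derivative `d` at `t`. -/
def HasDeltaDeriv (f : T → ℝ) (d : ℝ) (t : T) : Prop :=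
  ∀ ε : ℝ, 0 < ε → ∃ U ∈ 𝓝 t, ∀ s ∈ U,
    |(f (sigma t) - f s) - d * ((sigma t : ℝ) - s)| ≤ ε * |(sigma t : ℝ) - s|

/-- Delta derivative of a matrix-valued function, entry by entry. -/
def HasMatrixDeltaDeriv (X : T → Matrix (Fin n) (Fin n) ℝ) (D : Matrix (Fin n) (Fin n) ℝ)
    (t : T) : Prop :=
  ∀ i j, HasDeltaDeriv (fun s => X s i j) (D i j) t

/-- Rd-continuity: continuity at right-dense points and existence of finite left-sided limits
at left-dense points. -/
def RdContinuous (f : T → ℝ) : Prop :=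
  (∀ t : T, sigma t = t → ContinuousAt f t) ∧
    (∀ t : T, rho t = t → ∃ L : ℝ, Tendsto f (𝓝[<] t) (𝓝 L))

/-- Rd-continuity of a matrix-valued function, entry by entry. -/
def MatrixRdContinuous (X : T → Matrix (Fin n) (Fin n) ℝ) : Prop :=
  ∀ i j, RdContinuous (fun s => X s i j)

/-- The class `𝓡` of regressive matrix functions: rd-continuous, with `I + μ(t) A(t)` invertible
for all `t ∈ T^κ`. -/
def MatrixRegressive (A : T → Matrix (Fin n) (Fin n) ℝ) : Prop :=
  MatrixRdContinuous A ∧ ∀ t ∈ kappa T, IsUnit (1 + graininess t • A t)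

/-- The Lebesgue delta measure on `T`: Lebesgue measure on `T` together with an atom of mass `μ(t)`
at each right-scattered point `t` (the summands with `μ(t) = 0` vanish).  In particular the
interval `[a, b)` of `T` has measure `b - a`. -/
def deltaMeasure (T : TimeScale) : Measure T :=
  (volume : Measure ℝ).comap (Subtype.val : T → ℝ) +
    Measure.sum (fun t : T => ENNReal.ofReal (graininess t) • Measure.dirac t)

/-- The oriented delta integral `∫_a^b f(s) Δs`: the integral over `[a, b)` if `a ≤ b`, and
minus the integral over `[b, a)` if `b ≤ a`. -/
def deltaIntegral (f : T → ℝ) (a b : T) : ℝ :=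
  (∫ s in Set.Ico a b, f s ∂(deltaMeasure T)) - ∫ s in Set.Ico b a, f s ∂(deltaMeasure T)

/-- Delta integral of a matrix-valued function, entry by entry. -/
def matrixDeltaIntegral (F : T → Matrix (Fin n) (Fin n) ℝ) (a b : T) :
    Matrix (Fin n) (Fin n) ℝ :=
  Matrix.of fun i j => deltaIntegral (fun s => F s i j) a b

/-- `X` solves the initial value problem `X^Δ(t) = A(t) X(t)` on `T^κ`, `X(t₀) = I`. -/
def SolvesMatrixIVP (A : T → Matrix (Fin n) (Fin n) ℝ) (t₀ : T)
    (X : T → Matrix (Fin n) (Fin n) ℝ) : Prop :=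
  (∀ t ∈ kappa T, HasMatrixDeltaDeriv X (A t * X t) t) ∧ X t₀ = 1

/-- The transition matrix `t ↦ Φ_A(t, t₀)`: the solution of `X^Δ = A X`, `X(t₀) = I`. -/
def transitionMatrix (A : T → Matrix (Fin n) (Fin n) ℝ) (t₀ : T) :
    T → Matrix (Fin n) (Fin n) ℝ :=
  Classical.epsilon (SolvesMatrixIVP A t₀)

/-- `P` is delta differentiable on `T^κ`, satisfies the time scale dynamic Lyapunov equation
there, and satisfies `P(t₀) = P₀`. -/
def SolvesDynamicLyapunov (A M : T → Matrix (Fin n) (Fin n) ℝ) (t₀ : T)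
    (P₀ : Matrix (Fin n) (Fin n) ℝ) (P : T → Matrix (Fin n) (Fin n) ℝ) : Prop :=
  (∀ t ∈ kappa T, ∃ D : Matrix (Fin n) (Fin n) ℝ, HasMatrixDeltaDeriv P D t ∧
    (A t).transpose * P t + P t * A t + graininess t • ((A t).transpose * P t * A t)
      + (1 + graininess t • (A t).transpose) * D * (1 + graininess t • A t) = -M t) ∧
  P t₀ = P₀

end TimeScale

end

noncomputable section

namespace TimeScale

/-! ### Jump operators, the delta measure and rd-continuity. -/

section

variable {T : TimeScale} {E : Type*}

/-! The Lyapunov equation is a total derivative in disguise. If `X` is the transition matrix, the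
product rule together with `X(σ(t)) = (1 + μA)X(t)` turns the left-hand side, multiplied by `Xᵀ` on
the left and `X` on the right, into the delta derivative of `XᵀPX`. So `P` is a solution exactly
when `XᵀPX` has derivative `-XᵀMX` and the right initial value; integrating and undoing the
conjugation gives the closed form. Uniqueness follows because a function with zero delta derivative
is constant, a consequence of the mean value inequality `norm_sub_le_of_hasDeltaDerivWithin`.

The substance lies in the transition matrix. The Peano–Baker series solves a linear equation forward
from any starting point (`exists_forward_solution`). Backward solvability needs regressivity: the
adjoint equation `Y^Δ = -Y A (1 + μA)⁻¹` is again linear with rd-continuous coefficient, and `YX`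
has derivative zero, so forward solutions are invertible. Then `F(c,t) F(c,t₀)⁻¹`, for any `c` below
both `t` and `t₀`, is independent of `c` and solves the problem on both sides of `t₀`
(`exists_transition_pair`). The fundamental theorem `hasDeltaDerivWithin_setIntegral_Ico` supplies
both the series and the final integral. -/

theorem le_sigma (t : T) : t ≤ sigma t := by
  unfold sigma
  split_ifs with h
  · obtain ⟨s, hs⟩ := h
    exact Subtype.coe_le_coe.1 (le_csInf ⟨s, s.2, hs⟩ fun x hx => le_of_lt hx.2)
  · exact le_rfl

theorem sigma_le {t s : T} (h : t < s) : sigma t ≤ s := by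
  unfold sigma
  rw [dif_pos ⟨s, h⟩]
  exact Subtype.coe_le_coe.1 (csInf_le ⟨t, fun x hx => le_of_lt hx.2⟩ ⟨s.2, h⟩)

theorem rho_le (t : T) : rho t ≤ t := by
  unfold rho
  split_ifs with h
  · obtain ⟨s, hs⟩ := h
    exact Subtype.coe_le_coe.1 (csSup_le ⟨s, s.2, hs⟩ fun x hx => le_of_lt hx.2)
  · exact le_rfl

theorem le_rho {t s : T} (h : s < t) : s ≤ rho t := by
  unfold rho
  rw [dif_pos ⟨s, h⟩]
  exact Subtype.coe_le_coe.1 (le_csSup ⟨t, fun x hx => le_of_lt hx.2⟩ ⟨s.2, h⟩)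

theorem graininess_nonneg (t : T) : 0 ≤ graininess t := sub_nonneg.2 (le_sigma t)

theorem graininess_eq_zero {t : T} (h : sigma t = t) : graininess t = 0 := by
  simp [graininess, h]

theorem exists_between_of_sigma_eq {t b : T} (h : sigma t = t) (hb : t < b) {c : ℝ}
    (hc : (t : ℝ) < c) : ∃ s : T, t < s ∧ (s : ℝ) < c := by
  by_contra! H
  have h1 : c ≤ sigma t := by
    unfold sigma
    rw [dif_pos ⟨b, hb⟩]
    exact le_csInf ⟨b, b.2, hb⟩ fun x hx => H ⟨x, hx.1⟩ hx.2
  rw [h] at h1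
  exact absurd hc (not_lt.2 h1)

theorem sigma_eq_of_notMem_kappa {t : T} (h : t ∉ kappa T) : sigma t = t := by
  simp only [kappa, Set.mem_ofPred_eq, not_not] at h
  exact le_antisymm (h.1 _) (le_sigma t)

/-- A left-scattered maximum is isolated. Since `σ(t) = t` there as well, every value is a delta
derivative at such a point, so equations on `T^κ` extend to all of `T` for free. -/
theorem nhds_eq_pure_of_notMem_kappa {t : T} (h : t ∉ kappa T) : 𝓝 t = pure t := by
  simp only [kappa, Set.mem_ofPred_eq, not_not] at h
  refine le_antisymm ?_ (pure_le_nhds t)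
  rw [le_pure_iff]
  filter_upwards [isOpen_Ioi.mem_nhds h.2] with s hs
  refine le_antisymm (h.1 s) (not_lt.1 fun hst => ?_)
  exact absurd hs (not_lt.2 (le_rho hst))

theorem nhdsLT_eq_bot {t : T} (h : rho t ≠ t) : 𝓝[<] t = ⊥ := by
  have h1 : rho t < t := lt_of_le_of_ne (rho_le t) h
  rw [← empty_mem_iff_bot]
  have : Set.Ioi (rho t) ∩ Set.Iio t = ∅ := by
    ext s
    simp only [Set.mem_inter_iff, Set.mem_Ioi, Set.mem_Iio, Set.mem_empty_iff_false, iff_false,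
      not_and, not_lt]
    intro h2
    by_contra! h3
    exact absurd h2 (not_lt.2 (le_rho h3))
  rw [← this, Set.inter_comm]
  exact inter_mem_nhdsWithin _ (isOpen_Ioi.mem_nhds h1)

theorem nhdsGT_eq_bot {t : T} (h : sigma t ≠ t) : 𝓝[>] t = ⊥ := by
  have h1 : t < sigma t := lt_of_le_of_ne (le_sigma t) h.symm
  rw [← empty_mem_iff_bot]
  have : Set.Ioi t ∩ Set.Iio (sigma t) = ∅ := by
    ext s
    simp only [Set.mem_inter_iff, Set.mem_Ioi, Set.mem_Iio, Set.mem_empty_iff_false, iff_false,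
      not_and, not_lt]
    exact sigma_le
  rw [← this]
  exact inter_mem_nhdsWithin _ (isOpen_Iio.mem_nhds h1)

theorem Ico_sigma {t : T} (h : sigma t ≠ t) : Set.Ico t (sigma t) = {t} := by
  have h1 : t < sigma t := lt_of_le_of_ne (le_sigma t) h.symm
  ext s
  simp only [Set.mem_Ico, Set.mem_singleton_iff]
  constructor
  · rintro ⟨h2, h3⟩
    exact le_antisymm (not_lt.1 fun h4 => absurd h3 (not_lt.2 (sigma_le h4))) h2
  · rintro rfl
    exact ⟨le_rfl, h1⟩

theorem isClosedEmbedding_coe (T : TimeScale) :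
    IsClosedEmbedding (Subtype.val : T → ℝ) := T.isClosed.isClosedEmbedding_subtypeVal

theorem isCompact_Icc (a b : T) : IsCompact (Set.Icc a b) :=
  (isClosedEmbedding_coe T).isCompact_preimage (CompactIccSpace.isCompact_Icc (a := (a : ℝ)) (b := b))

theorem pairwiseDisjoint_Ioo_sigma :
    (Set.univ : Set T).PairwiseDisjoint fun t : T => Set.Ioo (t : ℝ) (sigma t) := by
  have key : ∀ s t : T, s < t → Disjoint (Set.Ioo (s : ℝ) (sigma s)) (Set.Ioo (t : ℝ) (sigma t)) := by
    intro s t h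
    refine Set.disjoint_left.2 fun x hx hy => ?_
    have h1 : (sigma s : ℝ) ≤ t := sigma_le h
    linarith [hx.2, hy.1]
  intro s _ t _ hst
  rcases lt_or_gt_of_ne hst with h | h
  · exact key s t h
  · exact (key t s h).symm

/-- The gaps `(t, σ(t))` are disjoint nonempty open intervals of the line. -/
theorem countable_setOf_sigma_ne (T : TimeScale) : {t : T | sigma t ≠ t}.Countable := by
  refine (pairwiseDisjoint_Ioo_sigma.subset (Set.subset_univ _)).countable_of_isOpen
    (fun _ _ => isOpen_Ioo) fun t ht => ?_
  exact Set.nonempty_Ioo.2 (Subtype.coe_lt_coe.2 (lt_of_le_of_ne (le_sigma t) (Ne.symm ht)))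

theorem Ico_eq_union_gaps (a b : T) : Set.Ico (a : ℝ) b = Subtype.val '' Set.Ico a b ∪
    ⋃ t ∈ {t : T | sigma t ≠ t} ∩ Set.Ico a b, Set.Ioo (t : ℝ) (sigma t) := by
  ext x
  constructor
  · intro hx
    by_cases hxT : x ∈ T.carrier
    · exact Or.inl ⟨⟨x, hxT⟩, hx, rfl⟩
    · right
      have hne : (T.carrier ∩ Set.Iic x).Nonempty := ⟨a, a.2, hx.1⟩
      have hbd : BddAbove (T.carrier ∩ Set.Iic x) := ⟨x, fun y hy => hy.2⟩
      have hm := (T.isClosed.inter isClosed_Iic).csSup_mem hne hbd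
      -- The left end of the gap containing `x` is the last point of `T` below `x`; it lies in `T`
      -- because `T` is closed.
      set t : T := ⟨sSup (T.carrier ∩ Set.Iic x), hm.1⟩ with ht
      have htx : (t : ℝ) < x := lt_of_le_of_ne hm.2 fun h => hxT (h ▸ t.2)
      have hat : a ≤ t := le_csSup hbd ⟨a.2, hx.1⟩
      have htb : t < b := htx.trans hx.2
      have hmax : ∀ s : T, t < s → x < s := fun s hs => by
        by_contra! h
        exact absurd hs (not_lt.2 (le_csSup hbd ⟨s.2, h⟩))
      have hσ : x ≤ sigma t := by
        unfold sigma
        rw [dif_pos ⟨b, htb⟩]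
        exact le_csInf ⟨b, b.2, htb⟩ fun y hy => (hmax ⟨y, hy.1⟩ hy.2).le
      have hσ' : x < sigma t := lt_of_le_of_ne hσ fun h => hxT (h ▸ (sigma t).2)
      have hne' : sigma t ≠ t := fun h => by rw [h] at hσ'; linarith
      exact Set.mem_biUnion (x := t) ⟨hne', hat, htb⟩ ⟨htx, hσ'⟩
  · rintro (⟨t, ht, rfl⟩ | hx)
    · exact ht
    · obtain ⟨t, ⟨-, ht⟩, hx⟩ := Set.mem_iUnion₂.1 hx
      have h1 : (sigma t : ℝ) ≤ b := sigma_le ht.2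
      have h2 : (a : ℝ) ≤ t := ht.1
      exact ⟨by linarith [hx.1], by linarith [hx.2]⟩

/-- The atom at a right-scattered point weighs as much as the gap that follows it, so the delta
measure of the interval is the Lebesgue measure of the full real interval. -/
theorem deltaMeasure_Ico (a b : T) :
    deltaMeasure T (Set.Ico a b) = ENNReal.ofReal ((b : ℝ) - a) := by
  have hms : MeasurableSet (Set.Ico a b) := measurableSet_Ico
  have hD : ({t : T | sigma t ≠ t} ∩ Set.Ico a b).Countable :=
    (countable_setOf_sigma_ne T).mono Set.inter_subset_left
  have hemb : MeasurableEmbedding (Subtype.val : T → ℝ) :=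
    (isClosedEmbedding_coe T).measurableEmbedding
  rw [← Real.volume_Ico, Ico_eq_union_gaps, measure_union, measure_biUnion hD, deltaMeasure,
    Measure.add_apply, hemb.comap_apply, Measure.sum_apply _ hms]
  · congr 1
    simp only [Real.volume_Ioo, Measure.smul_apply, smul_eq_mul]
    rw [tsum_subtype ({t : T | sigma t ≠ t} ∩ Set.Ico a b)
      (fun t : T => ENNReal.ofReal ((sigma t : ℝ) - t))]
    refine tsum_congr fun t => ?_
    rw [Measure.dirac_apply' _ hms]
    by_cases h1 : t ∈ Set.Ico a b <;> by_cases h2 : sigma t = t <;>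
      simp [Set.indicator, h1, h2, graininess]
  · exact pairwiseDisjoint_Ioo_sigma.subset (Set.subset_univ _)
  · exact fun _ _ => measurableSet_Ioo
  · refine Set.disjoint_left.2 ?_
    rintro _ ⟨s, -, rfl⟩ hx
    obtain ⟨t, -, hx⟩ := Set.mem_iUnion₂.1 hx
    exact absurd hx.2 (not_lt.2 (sigma_le hx.1))
  · exact MeasurableSet.biUnion hD fun _ _ => measurableSet_Ioo

theorem deltaMeasure_Ico_lt_top (a b : T) : deltaMeasure T (Set.Ico a b) < ⊤ := by
  rw [deltaMeasure_Ico]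
  exact ENNReal.ofReal_lt_top

theorem deltaMeasure_real_Ico {a b : T} (h : a ≤ b) :
    (deltaMeasure T).real (Set.Ico a b) = (b : ℝ) - a := by
  rw [Measure.real, deltaMeasure_Ico, ENNReal.toReal_ofReal (sub_nonneg.2 h)]

/-- Rd-continuity of a function with values in a topological space. -/
def IsRdContinuous [TopologicalSpace E] (f : T → E) : Prop :=
  (∀ t : T, sigma t = t → ContinuousAt f t) ∧
    (∀ t : T, rho t = t → ∃ L : E, Tendsto f (𝓝[<] t) (𝓝 L))

theorem _root_.Continuous.isRdContinuous [TopologicalSpace E] {f : T → E} (hf : Continuous f) :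
    IsRdContinuous f :=
  ⟨fun _ _ => hf.continuousAt, fun t _ => ⟨f t, hf.continuousAt.tendsto.mono_left nhdsWithin_le_nhds⟩⟩

theorem IsRdContinuous.comp [TopologicalSpace E] {F : Type*} [TopologicalSpace F] {f : T → E}
    (hf : IsRdContinuous f) {φ : E → F} (hφ : Continuous φ) : IsRdContinuous fun t => φ (f t) :=
  ⟨fun t ht => hφ.continuousAt.comp (hf.1 t ht), fun t ht =>
    let ⟨L, hL⟩ := hf.2 t ht
    ⟨φ L, (hφ.tendsto L).comp hL⟩⟩

theorem IsRdContinuous.prodMk [TopologicalSpace E] {F : Type*} [TopologicalSpace F] {f : T → E}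
    {g : T → F} (hf : IsRdContinuous f) (hg : IsRdContinuous g) :
    IsRdContinuous fun t => (f t, g t) :=
  ⟨fun t ht => (hf.1 t ht).prodMk (hg.1 t ht), fun t ht =>
    let ⟨L, hL⟩ := hf.2 t ht
    let ⟨K, hK⟩ := hg.2 t ht
    ⟨(L, K), hL.prodMk_nhds hK⟩⟩

theorem IsRdContinuous.mul [TopologicalSpace E] [Mul E] [ContinuousMul E] {f g : T → E}
    (hf : IsRdContinuous f) (hg : IsRdContinuous g) : IsRdContinuous fun t => f t * g t :=
  (hf.prodMk hg).comp continuous_mul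

theorem isRdContinuous_finset_sum {ι : Type*} [TopologicalSpace E] [AddCommMonoid E]
    [ContinuousAdd E] (s : Finset ι) {f : ι → T → E} (hf : ∀ i ∈ s, IsRdContinuous (f i)) :
    IsRdContinuous fun t => ∑ i ∈ s, f i t := by
  classical
  induction s using Finset.induction_on with
  | empty => simpa using continuous_const.isRdContinuous
  | insert i s hi ih =>
    simp only [Finset.sum_insert hi]
    exact ((hf i (by simp)).prodMk (ih fun j hj => hf j (by simp [hj]))).comp continuous_add

theorem tendsto_graininess_nhdsLT (t : T) : Tendsto (graininess : T → ℝ) (𝓝[<] t) (𝓝 0) := by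
  have h : Tendsto (fun s : T => (t : ℝ) - s) (𝓝[<] t) (𝓝 0) := by
    have : ContinuousAt (fun s : T => (t : ℝ) - s) t := by fun_prop
    simpa [ContinuousAt] using this.tendsto.mono_left nhdsWithin_le_nhds
  refine squeeze_zero' (Eventually.of_forall graininess_nonneg) ?_ h
  filter_upwards [self_mem_nhdsWithin] with s hs
  have : (sigma s : ℝ) ≤ t := sigma_le hs
  simp only [graininess]
  linarith

theorem isRdContinuous_graininess (T : TimeScale) : IsRdContinuous (graininess : T → ℝ) := by
  refine ⟨fun t ht => ?_, fun t _ => ⟨0, tendsto_graininess_nhdsLT t⟩⟩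
  rw [continuousAt_iff_continuous_left'_right']
  refine ⟨?_, ?_⟩
  · rw [ContinuousWithinAt, graininess_eq_zero ht]
    exact tendsto_graininess_nhdsLT t
  · rw [ContinuousWithinAt, graininess_eq_zero ht]
    by_cases hmax : ∃ b, t < b
    · obtain ⟨b, hb⟩ := hmax
      rw [Metric.tendsto_nhds]
      intro ε hε
      obtain ⟨c, hc, hcε⟩ := exists_between_of_sigma_eq ht hb (lt_add_of_pos_right (t : ℝ) hε)
      filter_upwards [inter_mem_nhdsWithin (Set.Ioi t) (isOpen_Iio.mem_nhds hc)] with s hs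
      -- No jump from a point below `c` can pass `c`, and `c` is within `ε` of `t`.
      have h1 : (sigma s : ℝ) ≤ c := sigma_le hs.2
      have h2 : (t : ℝ) < s := hs.1
      rw [Real.dist_0_eq_abs, abs_of_nonneg (graininess_nonneg s)]
      simp only [graininess]
      linarith
    · push Not at hmax
      have : 𝓝[>] t = ⊥ := by
        have : Set.Ioi t = ∅ := Set.eq_empty_of_forall_notMem fun s hs =>
          absurd hs (not_lt.2 (hmax s))
        rw [this, nhdsWithin_empty]
      rw [this]
      exact tendsto_bot

/-! ### Bounds, measurability and integrability of rd-continuous functions. -/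

section Normed
variable [NormedAddCommGroup E]

theorem IsRdContinuous.exists_bound_nhds {f : T → E} (hf : IsRdContinuous f) (t : T) :
    ∃ C : ℝ, ∀ᶠ s in 𝓝 t, ‖f s‖ ≤ C := by
  have key : ∀ {l : Filter T} {L : E}, Tendsto f l (𝓝 L) → ∃ C : ℝ, ∀ᶠ s in l, ‖f s‖ ≤ C :=
    fun {l L} h => ⟨‖L‖ + 1, (h.norm.eventually (gt_mem_nhds (lt_add_one _))).mono fun _ => le_of_lt⟩
  have h1 : ∃ C : ℝ, ∀ᶠ s in 𝓝[<] t, ‖f s‖ ≤ C := by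
    by_cases h : rho t = t
    · obtain ⟨L, hL⟩ := hf.2 t h
      exact key hL
    · rw [nhdsLT_eq_bot h]
      exact ⟨0, by simp⟩
  have h2 : ∃ C : ℝ, ∀ᶠ s in 𝓝[>] t, ‖f s‖ ≤ C := by
    by_cases h : sigma t = t
    · exact key ((hf.1 t h).tendsto.mono_left nhdsWithin_le_nhds)
    · rw [nhdsGT_eq_bot h]
      exact ⟨0, by simp⟩
  obtain ⟨C₁, h1⟩ := h1
  obtain ⟨C₂, h2⟩ := h2
  refine ⟨max ‖f t‖ (max C₁ C₂), ?_⟩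
  rw [eventually_nhdsWithin_iff] at h1 h2
  filter_upwards [h1, h2] with s hs1 hs2
  rcases lt_trichotomy s t with h | rfl | h
  · exact (hs1 h).trans (by simp)
  · simp
  · exact (hs2 h).trans (by simp)

theorem IsRdContinuous.exists_bound {f : T → E} (hf : IsRdContinuous f) (a b : T) :
    ∃ C : ℝ, 0 ≤ C ∧ ∀ s ∈ Set.Icc a b, ‖f s‖ ≤ C := by
  suffices h : ∃ C : ℝ, ∀ s ∈ Set.Icc a b, ‖f s‖ ≤ C by
    obtain ⟨C, hC⟩ := h
    exact ⟨max C 0, le_max_right _ _, fun s hs => (hC s hs).trans (le_max_left _ _)⟩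
  refine (isCompact_Icc a b).induction_on (p := fun S => ∃ C : ℝ, ∀ s ∈ S, ‖f s‖ ≤ C)
    ⟨0, by simp⟩ ?_ ?_ ?_
  · rintro S S' h ⟨C, hC⟩
    exact ⟨C, fun s hs => hC s (h hs)⟩
  · rintro S S' ⟨C, hC⟩ ⟨C', hC'⟩
    refine ⟨max C C', ?_⟩
    rintro s (hs | hs)
    · exact (hC s hs).trans (le_max_left _ _)
    · exact (hC' s hs).trans (le_max_right _ _)
  · intro t _
    obtain ⟨C, hC⟩ := hf.exists_bound_nhds t
    exact ⟨_, nhdsWithin_le_nhds hC, C, fun s hs => hs⟩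

/-- Discontinuities occur only at right-scattered points, which form a countable set. -/
theorem IsRdContinuous.stronglyMeasurable {f : T → E} (hf : IsRdContinuous f) :
    StronglyMeasurable f := by
  have hD := countable_setOf_sigma_ne T
  have := hD.to_subtype
  refine stronglyMeasurable_of_restrict_of_restrict_compl hD.measurableSet ?_ ?_
  · exact StronglyMeasurable.of_discrete
  · refine Continuous.stronglyMeasurable ?_
    rw [← continuousOn_iff_continuous_domRestrict]
    intro t ht
    exact (hf.1 t (by simpa using ht)).continuousWithinAt

theorem IsRdContinuous.integrableOn {f : T → E} (hf : IsRdContinuous f) (a b : T) :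
    IntegrableOn f (Set.Ico a b) (deltaMeasure T) := by
  obtain ⟨C, -, hC⟩ := hf.exists_bound a b
  refine Measure.integrableOn_of_bounded (M := C) (deltaMeasure_Ico_lt_top a b).ne
    hf.stronglyMeasurable.aestronglyMeasurable ?_
  refine (ae_restrict_iff' measurableSet_Ico).2 (Eventually.of_forall fun s hs => ?_)
  exact hC s (Set.Ico_subset_Icc_self hs)

end Normed

end

/-! ### Delta derivatives relative to a set, and the mean value inequality. -/

section

variable {T : TimeScale} {E : Type*} [NormedAddCommGroup E] [NormedSpace ℝ E]

/-- `f : T → E` has delta derivative `d` at `t` within the set `S`. -/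
def HasDeltaDerivWithin (f : T → E) (d : E) (S : Set T) (t : T) : Prop :=
  (fun s : T => f (sigma t) - f s - ((sigma t : ℝ) - s) • d) =o[𝓝[S] t]
    fun s : T => ((sigma t : ℝ) - s)

theorem hasDeltaDeriv_iff {f : T → ℝ} {d : ℝ} {t : T} :
    HasDeltaDeriv f d t ↔ HasDeltaDerivWithin f d Set.univ t := by
  rw [HasDeltaDerivWithin, Asymptotics.isLittleO_iff, nhdsWithin_univ]
  refine forall_congr' fun ε => forall_congr' fun _ => ?_
  rw [eventually_iff_exists_mem]
  simp only [Real.norm_eq_abs, smul_eq_mul, mul_comm d]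

theorem HasDeltaDerivWithin.mono {f : T → E} {d : E} {S S' : Set T} {t : T}
    (h : HasDeltaDerivWithin f d S t) (hS : S' ⊆ S) : HasDeltaDerivWithin f d S' t :=
  Asymptotics.IsLittleO.mono h (nhdsWithin_mono t hS)

theorem HasDeltaDerivWithin.congr_deriv {f : T → E} {d d' : E} {S : Set T} {t : T}
    (h : HasDeltaDerivWithin f d S t) (hd : d = d') : HasDeltaDerivWithin f d' S t := hd ▸ h

theorem hasDeltaDerivWithin_const (c : E) (S : Set T) (t : T) :
    HasDeltaDerivWithin (fun _ => c) 0 S t := by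
  simp [HasDeltaDerivWithin]

theorem HasDeltaDerivWithin.of_mem_nhds {f : T → E} {d : E} {S : Set T} {t : T}
    (h : HasDeltaDerivWithin f d S t) (hS : S ∈ 𝓝 t) : HasDeltaDerivWithin f d Set.univ t := by
  rw [HasDeltaDerivWithin, nhdsWithin_univ, ← nhdsWithin_eq_nhds.2 hS]
  exact h

theorem hasDeltaDerivWithin_of_notMem_kappa {t : T} (ht : t ∉ kappa T) (f : T → E) (d : E)
    (S : Set T) : HasDeltaDerivWithin f d S t := by
  refine Asymptotics.isLittleO_iff.2 fun ε hε => nhdsWithin_le_nhds ?_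
  rw [nhds_eq_pure_of_notMem_kappa ht]
  simp [sigma_eq_of_notMem_kappa ht]

/-- The derivative estimate may be evaluated at `s = t` itself, where it holds for every `ε` and so
forces equality. -/
theorem HasDeltaDerivWithin.apply_sigma {f : T → E} {d : E} {S : Set T} {t : T}
    (h : HasDeltaDerivWithin f d S t) (ht : t ∈ S) : f (sigma t) = f t + graininess t • d := by
  have h0 : ‖f (sigma t) - f t - graininess t • d‖ ≤ 0 := by
    refine le_of_forall_pos_le_add fun ε hε => ?_
    have hg := graininess_nonneg t
    have h1 := (Asymptotics.isLittleO_iff.1 h (c := ε / (graininess t + 1))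
      (by positivity)).self_of_nhdsWithin ht
    refine h1.trans ?_
    change ε / (graininess t + 1) * ‖graininess t‖ ≤ 0 + ε
    rw [Real.norm_of_nonneg hg, zero_add, div_mul_eq_mul_div, div_le_iff₀ (by positivity)]
    nlinarith
  have h1 := norm_le_zero_iff.1 h0
  rw [← sub_eq_zero, ← h1]
  abel

theorem tendsto_sigma_sub (S : Set T) (t : T) :
    Tendsto (fun s : T => (sigma t : ℝ) - s) (𝓝[S] t) (𝓝 (graininess t)) := by
  have : ContinuousAt (fun s : T => (sigma t : ℝ) - s) t := by fun_prop
  exact this.tendsto.mono_left nhdsWithin_le_nhds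

theorem HasDeltaDerivWithin.continuousWithinAt {f : T → E} {d : E} {S : Set T} {t : T}
    (h : HasDeltaDerivWithin f d S t) (ht : t ∈ S) : ContinuousWithinAt f S t := by
  have h1 : Tendsto (fun s : T => f (sigma t) - f s - ((sigma t : ℝ) - s) • d) (𝓝[S] t) (𝓝 0) :=
    (Asymptotics.isLittleO_one_iff ℝ).1 (h.trans_isBigO ((tendsto_sigma_sub S t).isBigO_one ℝ))
  have h2 := (h1.add ((tendsto_sigma_sub S t).smul_const d)).const_sub (f (sigma t))
  rw [ContinuousWithinAt]
  convert h2 using 2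
  · simp
  · rw [h.apply_sigma ht]
    abel

theorem HasDeltaDerivWithin.clm_comp {F : Type*} [NormedAddCommGroup F] [NormedSpace ℝ F]
    {f : T → E} {d : E} {S : Set T} {t : T} (h : HasDeltaDerivWithin f d S t) (φ : E →L[ℝ] F) :
    HasDeltaDerivWithin (fun s => φ (f s)) (φ d) S t := by
  refine Asymptotics.IsBigO.trans_isLittleO ?_ h
  refine (φ.isBigO_comp (fun s : T => f (sigma t) - f s - ((sigma t : ℝ) - s) • d) (𝓝[S] t)).congr_left
    fun s => ?_
  simp

theorem HasDeltaDerivWithin.sub {f g : T → E} {d e : E} {S : Set T} {t : T}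
    (hf : HasDeltaDerivWithin f d S t) (hg : HasDeltaDerivWithin g e S t) :
    HasDeltaDerivWithin (fun s => f s - g s) (d - e) S t := by
  refine (Asymptotics.IsLittleO.sub hf hg).congr_left fun s => ?_
  module

theorem HasDeltaDerivWithin.add_const {f : T → E} {d : E} {S : Set T} {t : T}
    (hf : HasDeltaDerivWithin f d S t) (c : E) :
    HasDeltaDerivWithin (fun s => f s + c) d S t := by
  refine Asymptotics.IsLittleO.congr_left hf fun s => ?_
  module

theorem HasDeltaDerivWithin.sum {ι : Type*} (u : Finset ι) {f : ι → T → E} {d : ι → E} {S : Set T}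
    {t : T} (h : ∀ i ∈ u, HasDeltaDerivWithin (f i) (d i) S t) :
    HasDeltaDerivWithin (fun s => ∑ i ∈ u, f i s) (∑ i ∈ u, d i) S t := by
  refine (Asymptotics.IsLittleO.sum h).congr_left fun s => ?_
  simp [Finset.sum_sub_distrib, Finset.smul_sum]

theorem HasDeltaDerivWithin.mul {𝔸 : Type*} [NormedRing 𝔸] [NormedAlgebra ℝ 𝔸] {f g : T → 𝔸}
    {d e : 𝔸} {S : Set T} {t : T} (hf : HasDeltaDerivWithin f d S t)
    (hg : HasDeltaDerivWithin g e S t) (ht : t ∈ S) :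
    HasDeltaDerivWithin (fun s => f s * g s) (d * g t + f (sigma t) * e) S t := by
  have hc := hg.continuousWithinAt ht
  have h1 : (fun s : T => (f (sigma t) - f s - ((sigma t : ℝ) - s) • d) * g s) =o[𝓝[S] t]
      fun s : T => ((sigma t : ℝ) - s) := by
    have := Asymptotics.IsLittleO.mul_isBigO hf (hc.tendsto.isBigO_one ℝ)
    simpa using this
  have h2 : (fun s : T => f (sigma t) * (g (sigma t) - g s - ((sigma t : ℝ) - s) • e)) =o[𝓝[S] t]
      fun s : T => ((sigma t : ℝ) - s) := Asymptotics.IsLittleO.const_mul_left hg _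
  have h3 : (fun s : T => ((sigma t : ℝ) - s) • (d * (g s - g t))) =o[𝓝[S] t]
      fun s : T => ((sigma t : ℝ) - s) := by
    have h4 : (fun s : T => d * (g s - g t)) =o[𝓝[S] t] fun _ : T => (1 : ℝ) := by
      rw [Asymptotics.isLittleO_one_iff]
      simpa using (hc.tendsto.sub_const (g t)).const_mul d
    -- The product rule carries `g t` where the splitting produces `g s`; continuity of `g` makes
    -- the difference negligible.
    have := (Asymptotics.isBigO_refl (fun s : T => ((sigma t : ℝ) - s)) (𝓝[S] t)).smul_isLittleO h4
    simpa using this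
  refine ((h1.add h2).add h3).congr_left fun s => ?_
  simp only [mul_sub, sub_mul, smul_sub, smul_add, smul_mul_assoc, mul_smul_comm]
  abel

/-- Mean value inequality on a time scale. -/
theorem norm_sub_le_of_hasDeltaDerivWithin {g D : T → E} {h : T → ℝ} (hh : Continuous h) {a b : T}
    (hab : a ≤ b) (hg : ∀ t, a ≤ t → HasDeltaDerivWithin g (D t) (Set.Ici a) t)
    (hD : ∀ t s, a ≤ t → t ≤ s → s ≤ b → ‖D t‖ * ((s : ℝ) - t) ≤ h s - h t) :
    ‖g b - g a‖ ≤ h b - h a := by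
  have hba : (a : ℝ) ≤ b := hab
  suffices H : ∀ ε : ℝ, 0 < ε → ‖g b - g a‖ ≤ h b - h a + ε * ((b : ℝ) - a) by
    refine le_of_forall_pos_le_add fun ε hε => (H (ε / ((b : ℝ) - a + 1)) (by
      have : 0 < (b : ℝ) - a + 1 := by linarith
      positivity)).trans ?_
    rw [div_mul_eq_mul_div, add_le_add_iff_left, div_le_iff₀ (by linarith)]
    nlinarith
  intro ε hε
  -- Induction along the time scale: this set is closed, contains `a`, and from each of its points
  -- before `b` one can move strictly to the right inside it. The slack `ε` absorbs the error of the
  -- derivative at right-dense points.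
  set S : Set T := {t ∈ Set.Icc a b | ‖g t - g a‖ ≤ h t - h a + ε * ((t : ℝ) - a)} with hS
  have hScl : IsClosed S := by
    refine isClosed_Icc.isClosed_le ?_ (by fun_prop)
    refine ContinuousOn.norm (ContinuousOn.sub (fun t ht => ?_) continuousOn_const)
    exact ((hg t ht.1).continuousWithinAt ht.1).mono Set.Icc_subset_Ici_self
  have hSI : Subtype.val '' S ⊆ Set.Icc (a : ℝ) b := by
    rintro _ ⟨t, ht, rfl⟩
    exact ht.1
  suffices hb : (b : ℝ) ∈ Subtype.val '' S by
    obtain ⟨t, ht, htb⟩ := hb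
    obtain rfl : t = b := Subtype.ext htb
    exact ht.2
  refine IsClosed.mem_of_ge_of_forall_exists_gt (a := (a : ℝ)) ?_ ⟨a, ⟨⟨le_rfl, hab⟩, by simp⟩, rfl⟩
    hba ?_
  · rw [Set.inter_eq_left.2 hSI]
    exact (isClosedEmbedding_coe T).isClosedMap _ hScl
  · rintro _ ⟨⟨t, ⟨⟨hat, -⟩, ht⟩, rfl⟩, -, htb⟩
    have htb : t < b := htb
    suffices ∃ s : T, t < s ∧ s ≤ b ∧ ‖g s - g t‖ ≤ ‖D t‖ * ((s : ℝ) - t) + ε * ((s : ℝ) - t) by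
      obtain ⟨s, hts, hsb, hs⟩ := this
      refine ⟨s, ⟨s, ⟨⟨hat.trans hts.le, hsb⟩, ?_⟩, rfl⟩, hts, hsb⟩
      have h1 := norm_sub_le_norm_sub_add_norm_sub (g s) (g t) (g a)
      have h2 := hD t s hat hts.le hsb
      linarith
    by_cases hσ : sigma t = t
    · have h1 := Asymptotics.isLittleO_iff.1 (hg t hat) hε
      rw [eventually_nhdsWithin_iff, Metric.eventually_nhds_iff] at h1
      obtain ⟨δ, hδ, h1⟩ := h1
      obtain ⟨s, hts, hsδ⟩ := exists_between_of_sigma_eq hσ htb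
        (lt_min (show (t : ℝ) < b from htb) (lt_add_of_pos_right (t : ℝ) hδ))
      have hts' : (t : ℝ) < s := hts
      have h2 := h1 (y := s) (by
        rw [Subtype.dist_eq, Real.dist_eq, abs_of_pos (sub_pos.2 hts')]
        linarith [hsδ.trans_le (min_le_right _ _)]) (hat.trans hts.le)
      refine ⟨s, hts, (hsδ.trans_le (min_le_left _ _)).le, ?_⟩
      rw [hσ, Real.norm_eq_abs, abs_sub_comm, abs_of_pos (sub_pos.2 hts'), norm_sub_rev] at h2
      have h3 := norm_sub_norm_le (g s - g t) (((s : ℝ) - t) • D t)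
      rw [norm_smul, Real.norm_of_nonneg (sub_pos.2 hts').le] at h3
      have h4 : ‖g s - g t - ((s : ℝ) - t) • D t‖ ≤ ε * ((s : ℝ) - t) := by
        refine le_of_eq_of_le ?_ h2
        congr 1
        rw [← neg_sub (s : ℝ) t, neg_smul]
        abel
      linarith
    -- At a right-scattered point the next point is `σ(t)`, and the increment is exactly `μ(t)
    -- D(t)`.
    · have hts : t < sigma t := lt_of_le_of_ne (le_sigma t) (Ne.symm hσ)
      refine ⟨sigma t, hts, sigma_le htb, ?_⟩
      have h0 := graininess_nonneg t
      rw [(hg t hat).apply_sigma hat, add_sub_cancel_left, norm_smul, Real.norm_of_nonneg h0]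
      have : 0 ≤ ε * graininess t := by positivity
      simp only [graininess] at this ⊢
      linarith

theorem eq_of_hasDeltaDerivWithin_zero {g : T → E} {a b : T} (hab : a ≤ b)
    (hg : ∀ t, a ≤ t → HasDeltaDerivWithin g 0 (Set.Ici a) t) : g b = g a := by
  have := norm_sub_le_of_hasDeltaDerivWithin (h := fun _ => 0) (D := fun _ => 0) continuous_const
    hab hg (by simp)
  simpa [sub_eq_zero] using this

theorem eq_of_hasDeltaDerivWithin_univ_zero {g : T → E}
    (hg : ∀ t, HasDeltaDerivWithin g 0 Set.univ t) (a b : T) : g a = g b := by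
  have key : ∀ c d : T, c ≤ d → g d = g c := fun c d hcd =>
    eq_of_hasDeltaDerivWithin_zero hcd fun t _ => (hg t).mono (Set.subset_univ _)
  rcases le_total a b with h | h
  · exact (key a b h).symm
  · exact key b a h

theorem continuous_of_hasDeltaDerivWithin_univ {g D : T → E}
    (hg : ∀ t, HasDeltaDerivWithin g (D t) Set.univ t) : Continuous g :=
  continuous_iff_continuousAt.2 fun t =>
    continuousWithinAt_univ _ _ |>.1 ((hg t).continuousWithinAt (Set.mem_univ t))

/-- Turns derivatives within a half-line into full derivatives: start the half-line strictly left of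
`t`, or at `t` when `t` is the minimum. -/
theorem exists_le_and_Ici_mem_nhds (a t : T) : ∃ c : T, c ≤ a ∧ c ≤ t ∧ Set.Ici c ∈ 𝓝 t := by
  by_cases h : ∃ c : T, c < t
  · obtain ⟨c, hc⟩ := h
    exact ⟨min c a, min_le_right _ _, (min_le_left _ _).trans hc.le,
      mem_of_superset (isOpen_Ioi.mem_nhds hc) fun s hs => (min_le_left c a).trans (le_of_lt hs)⟩
  · push Not at h
    exact ⟨t, h a, le_rfl, univ_mem' h⟩

theorem HasDeltaDerivWithin.congr_Ici {f g : T → E} {d : E} {c t : T}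
    (h : HasDeltaDerivWithin f d (Set.Ici c) t) (hct : c ≤ t) (hfg : ∀ s, c ≤ s → g s = f s) :
    HasDeltaDerivWithin g d (Set.Ici c) t := by
  refine Asymptotics.IsLittleO.congr' h ?_ EventuallyEq.rfl
  filter_upwards [self_mem_nhdsWithin] with s hs
  rw [hfg s hs, hfg (sigma t) (hct.trans (le_sigma t))]

/-! ### The fundamental theorem of calculus for the delta integral. -/

section Integral

variable {f : T → E}

theorem setIntegral_Ico_sub (hf : IsRdContinuous f) {a s t : T} (has : a ≤ s) (hst : s ≤ t) :
    (∫ r in Set.Ico a t, f r ∂deltaMeasure T) - ∫ r in Set.Ico a s, f r ∂deltaMeasure T =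
      ∫ r in Set.Ico s t, f r ∂deltaMeasure T := by
  rw [← Set.Ico_union_Ico_eq_Ico has hst, setIntegral_union _ measurableSet_Ico
    (hf.integrableOn a s) (hf.integrableOn s t), add_sub_cancel_left]
  exact Set.disjoint_left.2 fun x hx hx' => absurd hx.2 (not_lt.2 hx'.1)

variable [CompleteSpace E]

theorem norm_setIntegral_Ico_sub_smul_le (hf : IsRdContinuous f) {s t : T} (hst : s ≤ t) {c : E}
    {ε : ℝ} (hε : ∀ r ∈ Set.Ico s t, ‖f r - c‖ ≤ ε) :
    ‖(∫ r in Set.Ico s t, f r ∂deltaMeasure T) - ((t : ℝ) - s) • c‖ ≤ ε * ((t : ℝ) - s) := by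
  have hfin := deltaMeasure_Ico_lt_top s t
  rw [← deltaMeasure_real_Ico hst, ← setIntegral_const, ← integral_sub (hf.integrableOn s t)
    (integrableOn_const hfin.ne)]
  exact norm_setIntegral_le_of_norm_le_const hfin hε

theorem norm_setIntegral_Ico_sub_sub_smul_le (hf : IsRdContinuous f) {a s t : T} (has : a ≤ s)
    (hat : a ≤ t) {c : E} {ε : ℝ} (hε : ∀ r ∈ Set.uIcc s t, ‖f r - c‖ ≤ ε) :
    ‖(∫ r in Set.Ico a t, f r ∂deltaMeasure T) - (∫ r in Set.Ico a s, f r ∂deltaMeasure T) -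
      ((t : ℝ) - s) • c‖ ≤ ε * |(t : ℝ) - s| := by
  rcases le_total s t with h | h
  · rw [Set.uIcc_of_le h] at hε
    rw [setIntegral_Ico_sub hf has h, abs_of_nonneg (sub_nonneg.2 (Subtype.coe_le_coe.2 h))]
    exact norm_setIntegral_Ico_sub_smul_le hf h fun r hr => hε r (Set.Ico_subset_Icc_self hr)
  · rw [Set.uIcc_of_ge h] at hε
    rw [abs_sub_comm, abs_of_nonneg (sub_nonneg.2 (Subtype.coe_le_coe.2 h)), ← norm_neg]
    refine le_of_eq_of_le ?_ (norm_setIntegral_Ico_sub_smul_le hf h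
      fun r hr => hε r (Set.Ico_subset_Icc_self hr))
    rw [← setIntegral_Ico_sub hf hat h, ← neg_sub (s : ℝ) t, neg_smul]
    congr 1
    abel

/-- The fundamental theorem of calculus for the delta integral. -/
theorem hasDeltaDerivWithin_setIntegral_Ico (hf : IsRdContinuous f) {a t : T} (hat : a ≤ t) :
    HasDeltaDerivWithin (fun t => ∫ r in Set.Ico a t, f r ∂deltaMeasure T) (f t) (Set.Ici a) t := by
  have key : ∀ ε : ℝ, (∀ᶠ r in 𝓝 t, ‖f r - f t‖ ≤ ε) → ∀ᶠ s in 𝓝[Set.Ici a] t,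
      ‖(∫ r in Set.Ico a t, f r ∂deltaMeasure T) - (∫ r in Set.Ico a s, f r ∂deltaMeasure T) -
      ((t : ℝ) - s) • f t‖ ≤ ε * |(t : ℝ) - s| := by
    intro ε hε
    obtain ⟨δ, hδ, hδε⟩ := Metric.eventually_nhds_iff.1 hε
    filter_upwards [self_mem_nhdsWithin, nhdsWithin_le_nhds (Metric.ball_mem_nhds t hδ)] with s hs hsδ
    refine norm_setIntegral_Ico_sub_sub_smul_le hf hs hat fun r hr => hδε ?_
    rw [Metric.mem_ball, dist_comm, Subtype.dist_eq, Real.dist_eq] at hsδ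
    rw [dist_comm, Subtype.dist_eq, Real.dist_eq]
    refine lt_of_le_of_lt ?_ hsδ
    rcases le_total s t with h | h
    · have hs' : (s : ℝ) ≤ t := h
      rw [Set.uIcc_of_le h] at hr
      have h1 : (s : ℝ) ≤ r := hr.1
      have h2 : (r : ℝ) ≤ t := hr.2
      rw [abs_of_nonneg (sub_nonneg.2 (show (r : ℝ) ≤ t from h2)), abs_of_nonneg (sub_nonneg.2 hs')]
      linarith
    · have hs' : (t : ℝ) ≤ s := h
      rw [Set.uIcc_of_ge h] at hr
      have h1 : (t : ℝ) ≤ r := hr.1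
      have h2 : (r : ℝ) ≤ s := hr.2
      rw [abs_of_nonpos (sub_nonpos.2 h1), abs_of_nonpos (sub_nonpos.2 hs')]
      linarith
  refine Asymptotics.isLittleO_iff.2 fun ε hε => ?_
  by_cases hσ : sigma t = t
  · rw [hσ]
    refine key ε ?_
    filter_upwards [Metric.continuousAt_iff'.1 (hf.1 t hσ) ε hε] with r hr
    rw [← dist_eq_norm]
    exact hr.le
  · have hts : t < sigma t := lt_of_le_of_ne (le_sigma t) (Ne.symm hσ)
    have hts' : (t : ℝ) < sigma t := hts
    -- At a right-scattered point `f` need not be continuous, but local boundedness suffices: the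
    -- error tends to zero, while `σ(t) - s` stays at least `μ(t) > 0` for `s` near `t`.
    obtain ⟨C, hC⟩ := hf.exists_bound_nhds t
    have hK := key (C + ‖f t‖) (hC.mono fun r hr => (norm_sub_le _ _).trans (by linarith))
    have hlim : Tendsto (fun s : T => (C + ‖f t‖) * |(t : ℝ) - s|) (𝓝[Set.Ici a] t) (𝓝 0) := by
      have : ContinuousAt (fun s : T => (C + ‖f t‖) * |(t : ℝ) - s|) t := by fun_prop
      simpa [ContinuousAt] using this.tendsto.mono_left nhdsWithin_le_nhds
    have hpos : 0 < ε * ((sigma t : ℝ) - t) := mul_pos hε (sub_pos.2 hts')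
    filter_upwards [hK, hlim.eventually (gt_mem_nhds hpos),
      nhdsWithin_le_nhds (isOpen_Iio.mem_nhds hts)] with s hs1 hs2 hs3
    have hst : (s : ℝ) ≤ t := not_lt.1 fun h => absurd hs3 (not_lt.2 (sigma_le h))
    -- The interval `[t, σ(t))` is the single atom `t`, so the integral over it is exact.
    have h1 : (∫ r in Set.Ico a (sigma t), f r ∂deltaMeasure T) =
        (∫ r in Set.Ico a t, f r ∂deltaMeasure T) + ((sigma t : ℝ) - t) • f t := by
      have h2 := norm_setIntegral_Ico_sub_smul_le hf hts.le (c := f t) (ε := 0) (by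
        rw [Ico_sigma hσ]
        simp)
      rw [zero_mul, norm_le_zero_iff, sub_eq_zero, ← setIntegral_Ico_sub hf hat hts.le] at h2
      rw [← h2]
      abel
    have h2 : (∫ r in Set.Ico a (sigma t), f r ∂deltaMeasure T) -
        (∫ r in Set.Ico a s, f r ∂deltaMeasure T) - ((sigma t : ℝ) - s) • f t =
        (∫ r in Set.Ico a t, f r ∂deltaMeasure T) - (∫ r in Set.Ico a s, f r ∂deltaMeasure T) -
      ((t : ℝ) - s) • f t := by
      rw [h1, sub_smul, sub_smul, sub_smul]
      abel
    rw [h2, Real.norm_of_nonneg (by linarith)]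
    refine hs1.trans (hs2.le.trans ?_)
    gcongr

theorem continuous_setIntegral_Ico (hf : IsRdContinuous f) (a : T) :
    Continuous fun t => ∫ r in Set.Ico a t, f r ∂deltaMeasure T := by
  have h1 : ContinuousOn (fun t => ∫ r in Set.Ico a t, f r ∂deltaMeasure T) (Set.Ici a) :=
    fun t ht => (hasDeltaDerivWithin_setIntegral_Ico hf ht).continuousWithinAt ht
  have h2 : ContinuousOn (fun t => ∫ r in Set.Ico a t, f r ∂deltaMeasure T) (Set.Iic a) := by
    refine (continuousOn_const (c := 0)).congr fun t ht => ?_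
    simp [Set.Ico_eq_empty_of_le (Set.mem_Iic.1 ht)]
  rw [← continuousOn_univ, ← Set.Iic_union_Ici (a := a)]
  exact h2.union_of_isClosed h1 isClosed_Iic isClosed_Ici

/-- The oriented form of the fundamental theorem of calculus. -/
theorem hasDeltaDeriv_deltaIntegral {f : T → ℝ} (hf : IsRdContinuous f) (a t : T) :
    HasDeltaDerivWithin (deltaIntegral f a) (f t) Set.univ t := by
  obtain ⟨c, hca, hct, hc⟩ := exists_le_and_Ici_mem_nhds a t
  refine HasDeltaDerivWithin.of_mem_nhds (S := Set.Ici c) ?_ hc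
  have h1 := (hasDeltaDerivWithin_setIntegral_Ico hf hct).add_const
    (-∫ r in Set.Ico c a, f r ∂deltaMeasure T)
  have h2 : ∀ s, c ≤ s → deltaIntegral f a s = (∫ r in Set.Ico c s, f r ∂deltaMeasure T) +
      -∫ r in Set.Ico c a, f r ∂deltaMeasure T := by
    intro s hs
    rw [deltaIntegral, ← sub_eq_add_neg]
    rcases le_total a s with h | h
    · rw [setIntegral_Ico_sub hf hca h, Set.Ico_eq_empty_of_le h]
      simp
    · rw [← neg_sub (∫ r in Set.Ico c a, f r ∂deltaMeasure T), setIntegral_Ico_sub hf hs h,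
        Set.Ico_eq_empty_of_le h]
      simp
  exact h1.congr_Ici hct h2

end Integral

end

/-! ### The Peano–Baker series for linear dynamic equations. -/

section

variable {T : TimeScale} {E : Type*} [NormedAddCommGroup E] [NormedSpace ℝ E]

/-- The terms of the Peano–Baker series of the linear dynamic equation `x^Δ = L x`,
`x a = x₀`. -/
def peanoBaker (L : T → E →L[ℝ] E) (a : T) (x₀ : E) : ℕ → T → E
  | 0 => fun _ => x₀
  | k + 1 => fun t => ∫ s in Set.Ico a t, L s (peanoBaker L a x₀ k s) ∂deltaMeasure T

theorem IsRdContinuous.clm_apply {L : T → E →L[ℝ] E} {x : T → E} (hL : IsRdContinuous L)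
    (hx : IsRdContinuous x) : IsRdContinuous fun t => L t (x t) :=
  (hL.prodMk hx).comp (φ := fun p : (E →L[ℝ] E) × E => p.1 p.2)
    isBoundedBilinearMap_apply.continuous

theorem peanoBaker_succ_of_le (L : T → E →L[ℝ] E) {a t : T} (h : t ≤ a) (x₀ : E) (k : ℕ) :
    peanoBaker L a x₀ (k + 1) t = 0 := by
  simp [peanoBaker, Set.Ico_eq_empty_of_le h]

variable [CompleteSpace E] {L : T → E →L[ℝ] E}

theorem continuous_peanoBaker (hL : IsRdContinuous L) (a : T) (x₀ : E) (k : ℕ) :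
    Continuous (peanoBaker L a x₀ k) := by
  induction k with
  | zero => exact continuous_const
  | succ k ih => exact continuous_setIntegral_Ico (hL.clm_apply ih.isRdContinuous) a

/-- An exponential weight with rate `2C`, twice the bound on `L`, makes each integration gain a
factor `1/2`. The mean value inequality needs only `1 + x ≤ exp x`, so the ordinary exponential
serves on every time scale. -/
theorem norm_peanoBaker_le_exp (hL : IsRdContinuous L) {a b : T} (x₀ : E) {C : ℝ} (hC0 : 0 ≤ C)
    (hC : ∀ s ∈ Set.Icc a b, ‖L s‖ ≤ C) (k : ℕ) (t : T) (ht : t ∈ Set.Icc a b) :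
    ‖peanoBaker L a x₀ k t‖ ≤ ‖x₀‖ * (1 / 2) ^ k * Real.exp (2 * C * ((t : ℝ) - a)) := by
  induction k generalizing t with
  | zero =>
    have h1 : 0 ≤ (t : ℝ) - a := sub_nonneg.2 ht.1
    have h2 : 1 ≤ Real.exp (2 * C * ((t : ℝ) - a)) := Real.one_le_exp (by positivity)
    simpa [peanoBaker] using le_mul_of_one_le_right (norm_nonneg x₀) h2
  | succ k ih =>
    have h1 := norm_sub_le_of_hasDeltaDerivWithin (g := peanoBaker L a x₀ (k + 1))
      (D := fun t => L t (peanoBaker L a x₀ k t)) (a := a) (b := t)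
      (h := fun t => ‖x₀‖ * (1 / 2) ^ (k + 1) * Real.exp (2 * C * ((t : ℝ) - a))) (by fun_prop) ht.1
      (fun s hs => hasDeltaDerivWithin_setIntegral_Ico
        (hL.clm_apply (continuous_peanoBaker hL a x₀ k).isRdContinuous) hs) ?_
    · rw [peanoBaker_succ_of_le L le_rfl, sub_zero] at h1
      refine h1.trans (sub_le_self _ (by positivity))
    · intro r s har hrs hst
      have hrI : r ∈ Set.Icc a b := ⟨har, hrs.trans (hst.trans ht.2)⟩
      have hrs' : 0 ≤ (s : ℝ) - r := sub_nonneg.2 hrs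
      have h2 : ‖L r (peanoBaker L a x₀ k r)‖ ≤
          C * (‖x₀‖ * (1 / 2) ^ k * Real.exp (2 * C * ((r : ℝ) - a))) :=
        (L r).le_of_opNorm_le_of_le (hC r hrI) (ih r hrI)
      have h3 : Real.exp (2 * C * ((s : ℝ) - a)) =
          Real.exp (2 * C * ((r : ℝ) - a)) * Real.exp (2 * C * ((s : ℝ) - r)) := by
        rw [← Real.exp_add]
        ring_nf
      have h4 := Real.add_one_le_exp (2 * C * ((s : ℝ) - r))
      calc ‖L r (peanoBaker L a x₀ k r)‖ * ((s : ℝ) - r)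
          ≤ C * (‖x₀‖ * (1 / 2) ^ k * Real.exp (2 * C * ((r : ℝ) - a))) * ((s : ℝ) - r) := by gcongr
        _ = ‖x₀‖ * (1 / 2) ^ (k + 1) * Real.exp (2 * C * ((r : ℝ) - a)) *
              (2 * C * ((s : ℝ) - r)) := by ring
        _ ≤ ‖x₀‖ * (1 / 2) ^ (k + 1) * Real.exp (2 * C * ((r : ℝ) - a)) *
              (Real.exp (2 * C * ((s : ℝ) - r)) - 1) := by gcongr; linarith
        _ = _ := by rw [h3]; ring

theorem norm_peanoBaker_le (hL : IsRdContinuous L) {a b : T} (hab : a ≤ b) (x₀ : E) {C : ℝ}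
    (hC0 : 0 ≤ C) (hC : ∀ s ∈ Set.Icc a b, ‖L s‖ ≤ C) (k : ℕ) (t : T) (ht : t ≤ b) :
    ‖peanoBaker L a x₀ k t‖ ≤ ‖x₀‖ * Real.exp (2 * C * ((b : ℝ) - a)) * (1 / 2) ^ k := by
  have hab' : 0 ≤ (b : ℝ) - a := sub_nonneg.2 hab
  rw [mul_right_comm]
  rcases le_total a t with h | h
  · have htb : (t : ℝ) ≤ b := ht
    refine (norm_peanoBaker_le_exp hL x₀ hC0 hC k t ⟨h, ht⟩).trans ?_
    gcongr
  · cases k with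
    | zero =>
      have h2 : 1 ≤ Real.exp (2 * C * ((b : ℝ) - a)) := Real.one_le_exp (by positivity)
      simpa [peanoBaker] using le_mul_of_one_le_right (norm_nonneg x₀) h2
    | succ k =>
      rw [peanoBaker_succ_of_le L h, norm_zero]
      positivity

theorem summable_peanoBaker (hL : IsRdContinuous L) (a : T) (x₀ : E) (t : T) :
    Summable fun k => peanoBaker L a x₀ k t := by
  obtain ⟨C, hC0, hC⟩ := hL.exists_bound a (max a t)
  exact Summable.of_norm_bounded (summable_geometric_two.mul_left _) fun k =>
    norm_peanoBaker_le hL (le_max_left a t) x₀ hC0 hC k t (le_max_right a t)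

theorem continuous_tsum_peanoBaker (hL : IsRdContinuous L) (a : T) (x₀ : E) :
    Continuous fun t => ∑' k, peanoBaker L a x₀ k t := by
  refine continuous_iff_continuousAt.2 fun t => ?_
  obtain ⟨b, hab, hb⟩ : ∃ b : T, a ≤ b ∧ Set.Iic b ∈ 𝓝 t := by
    by_cases h : ∃ b : T, t < b
    · obtain ⟨b, hb⟩ := h
      exact ⟨max a b, le_max_left _ _, mem_of_superset (isOpen_Iio.mem_nhds hb) fun s hs =>
        (le_of_lt hs).trans (le_max_right a b)⟩
    · push Not at h
      exact ⟨max a t, le_max_left _ _, univ_mem' fun s => (h s).trans (le_max_right a t)⟩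
  obtain ⟨C, hC0, hC⟩ := hL.exists_bound a b
  exact (continuousOn_tsum (fun k => (continuous_peanoBaker hL a x₀ k).continuousOn)
    (summable_geometric_two.mul_left _)
    fun k s hs => norm_peanoBaker_le hL hab x₀ hC0 hC k s hs).continuousAt hb

theorem tsum_peanoBaker_eq (hL : IsRdContinuous L) (a : T) (x₀ : E) (t : T) :
    ∑' k, peanoBaker L a x₀ k t =
      (∫ s in Set.Ico a t, L s (∑' k, peanoBaker L a x₀ k s) ∂deltaMeasure T) + x₀ := by
  have hint : ∀ k, IntegrableOn (fun s => L s (peanoBaker L a x₀ k s)) (Set.Ico a t)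
      (deltaMeasure T) := fun k =>
    (hL.clm_apply (continuous_peanoBaker hL a x₀ k).isRdContinuous).integrableOn a t
  obtain ⟨C, hC0, hC⟩ := hL.exists_bound a (max a t)
  have hsum : Summable fun k => ∫ s in Set.Ico a t, ‖L s (peanoBaker L a x₀ k s)‖
      ∂deltaMeasure T := by
    refine Summable.of_norm_bounded (g := fun k : ℕ => (C * (‖x₀‖ *
      Real.exp (2 * C * (((max a t : T) : ℝ) - a)) * (1 / 2) ^ k)) *
        (deltaMeasure T).real (Set.Ico a t))
      (((summable_geometric_two.mul_left _).mul_left _).mul_right _) fun k => ?_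
    refine norm_setIntegral_le_of_norm_le_const (deltaMeasure_Ico_lt_top a t) fun s hs => ?_
    rw [norm_norm]
    have hst : s ≤ max a t := hs.2.le.trans (le_max_right a t)
    exact (L s).le_of_opNorm_le_of_le (hC s ⟨hs.1, hst⟩)
      (norm_peanoBaker_le hL (le_max_left a t) x₀ hC0 hC k s hst)
  -- The zeroth term is `x₀`; the others are integrals of their predecessors, and the geometric
  -- bound lets sum and integral be exchanged.
  rw [(summable_peanoBaker hL a x₀ t).tsum_eq_zero_add, add_comm]
  congr 1
  have := (hasSum_integral_of_summable_integral_norm hint hsum).tsum_eq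
  simp only [(L _).map_tsum (summable_peanoBaker hL a x₀ _)]
  exact this

/-- Forward existence for the linear dynamic equation `x^Δ = L x`, `x a = x₀`. -/
theorem exists_forward_solution (hL : IsRdContinuous L) (a : T) (x₀ : E) :
    ∃ x : T → E, x a = x₀ ∧
      ∀ t, a ≤ t → HasDeltaDerivWithin x (L t (x t)) (Set.Ici a) t := by
  refine ⟨fun t => ∑' k, peanoBaker L a x₀ k t, ?_, fun t ht => ?_⟩
  · simp [tsum_peanoBaker_eq hL a x₀ a]
  · exact ((hasDeltaDerivWithin_setIntegral_Ico (hL.clm_apply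
      (continuous_tsum_peanoBaker hL a x₀).isRdContinuous) ht).add_const x₀).congr_Ici ht
      fun s _ => tsum_peanoBaker_eq hL a x₀ s

end

/-! ### Regressivity, the adjoint equation and the transition function. -/

section

variable {T : TimeScale} {𝔸 : Type*} [NormedRing 𝔸] [NormedAlgebra ℝ 𝔸] {A : T → 𝔸}

/-- The inverse of `1 + μ(t) A(t)`. -/
def regressiveInv (A : T → 𝔸) (t : T) : 𝔸 := Ring.inverse (1 + graininess t • A t)

theorem mul_regressiveInv {t : T} (h : IsUnit (1 + graininess t • A t)) :
    (1 + graininess t • A t) * regressiveInv A t = 1 := Ring.mul_inverse_cancel _ h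

theorem regressiveInv_mul {t : T} (h : IsUnit (1 + graininess t • A t)) :
    regressiveInv A t * (1 + graininess t • A t) = 1 := Ring.inverse_mul_cancel _ h

theorem mul_regressiveInv_comm {t : T} (h : IsUnit (1 + graininess t • A t)) :
    A t * regressiveInv A t = regressiveInv A t * A t := by
  have h1 : A t * (1 + graininess t • A t) = (1 + graininess t • A t) * A t := by
    simp [mul_add, add_mul]
  calc A t * regressiveInv A t
      = regressiveInv A t * (1 + graininess t • A t) * A t * regressiveInv A t := by
        rw [regressiveInv_mul h, one_mul]
    _ = regressiveInv A t * A t * ((1 + graininess t • A t) * regressiveInv A t) := by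
        rw [mul_assoc (regressiveInv A t), ← h1]
        simp only [mul_assoc]
    _ = _ := by rw [mul_regressiveInv h, mul_one]

theorem HasDeltaDerivWithin.apply_sigma_eq_mul_regressiveInv {Y : T → 𝔸} {S : Set T} {t : T}
    (hA : IsUnit (1 + graininess t • A t))
    (hY : HasDeltaDerivWithin Y (-(Y t * (A t * regressiveInv A t))) S t) (ht : t ∈ S) :
    Y (sigma t) = Y t * regressiveInv A t := by
  have h1 : regressiveInv A t + graininess t • (A t * regressiveInv A t) = 1 := by
    rw [← smul_mul_assoc, ← one_add_mul, mul_regressiveInv hA]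
  have h2 : Y t * regressiveInv A t + graininess t • (Y t * (A t * regressiveInv A t)) = Y t := by
    rw [← mul_smul_comm, ← mul_add, h1, mul_one]
  rw [hY.apply_sigma ht, smul_neg, ← sub_eq_add_neg, sub_eq_iff_eq_add, h2]

/-- With `Y(σ(t)) = Y(t)(1 + μA)⁻¹`, the two terms of the product rule cancel because `A` commutes
with `(1 + μA)⁻¹`. -/
theorem HasDeltaDerivWithin.adjoint_mul {Y Z : T → 𝔸} {S : Set T} {t : T}
    (hA : IsUnit (1 + graininess t • A t))
    (hY : HasDeltaDerivWithin Y (-(Y t * (A t * regressiveInv A t))) S t)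
    (hZ : HasDeltaDerivWithin Z (A t * Z t) S t) (ht : t ∈ S) :
    HasDeltaDerivWithin (fun s => Y s * Z s) 0 S t := by
  have h := hY.mul hZ ht
  rwa [hY.apply_sigma_eq_mul_regressiveInv hA ht, mul_regressiveInv_comm hA, neg_mul,
    show Y t * regressiveInv A t * (A t * Z t) = Y t * (regressiveInv A t * A t) * Z t by
      simp only [mul_assoc], neg_add_cancel] at h

variable [CompleteSpace 𝔸]

theorem isRdContinuous_regressiveInv (hA : IsRdContinuous A)
    (hreg : ∀ t, IsUnit (1 + graininess t • A t)) : IsRdContinuous (regressiveInv A) := by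
  have hB : IsRdContinuous fun t => 1 + graininess t • A t :=
    ((isRdContinuous_graininess T).prodMk hA).comp (φ := fun p : ℝ × 𝔸 => 1 + p.1 • p.2)
      (by fun_prop)
  refine ⟨fun t ht => ?_, fun t ht => ?_⟩
  · obtain ⟨u, hu⟩ := hreg t
    exact ContinuousAt.comp (g := Ring.inverse)
      (hu ▸ NormedRing.inverse_continuousAt u) (hB.1 t ht)
  · obtain ⟨L, hL⟩ := hA.2 t ht
    -- The graininess vanishes from the left while `A` has a finite limit, so the limit is `1`, a
    -- unit, and inversion is continuous there.
    have h1 : Tendsto (fun s => 1 + graininess s • A s) (𝓝[<] t) (𝓝 ((1 : 𝔸ˣ) : 𝔸)) := by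
      simpa using ((tendsto_graininess_nhdsLT t).smul hL).const_add 1
    exact ⟨_, (NormedRing.inverse_continuousAt (1 : 𝔸ˣ)).tendsto.comp h1⟩

theorem exists_forward_pair (hA : IsRdContinuous A)
    (hreg : ∀ t, IsUnit (1 + graininess t • A t)) (a : T) :
    ∃ X Y : T → 𝔸, X a = 1 ∧ Y a = 1 ∧
      (∀ t, a ≤ t → HasDeltaDerivWithin X (A t * X t) (Set.Ici a) t) ∧
      ∀ t, a ≤ t → HasDeltaDerivWithin Y (-(Y t * (A t * regressiveInv A t))) (Set.Ici a) t := by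
  obtain ⟨X, hXa, hX⟩ := exists_forward_solution (L := fun t => ContinuousLinearMap.mul ℝ 𝔸 (A t))
    (hA.comp (ContinuousLinearMap.mul ℝ 𝔸).continuous) a 1
  obtain ⟨Y, hYa, hY⟩ := exists_forward_solution
    (L := fun t => -(ContinuousLinearMap.mul ℝ 𝔸).flip (A t * regressiveInv A t))
    ((hA.mul (isRdContinuous_regressiveInv hA hreg)).comp
      (ContinuousLinearMap.mul ℝ 𝔸).flip.continuous.neg) a 1
  exact ⟨X, Y, hXa, hYa, hX, hY⟩

variable [IsDedekindFiniteMonoid 𝔸]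

/-- Existence of the transition function, together with its inverse and their derivatives. -/
theorem exists_transition_pair (hA : IsRdContinuous A)
    (hreg : ∀ t, IsUnit (1 + graininess t • A t)) (t₀ : T) :
    ∃ X Y : T → 𝔸, X t₀ = 1 ∧ (∀ t, Y t * X t = 1) ∧
      (∀ t, HasDeltaDerivWithin X (A t * X t) Set.univ t) ∧
      ∀ t, HasDeltaDerivWithin Y (-(Y t * (A t * regressiveInv A t))) Set.univ t := by
  choose F G hF1 hG1 hF hG using exists_forward_pair hA hreg
  -- The product is constant in `t` on the half-line from `c`, and at `t = c` the factor `G` is `1`.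
  have hGF' : ∀ a c t, a ≤ c → c ≤ t → G c t * F a t = F a c := fun a c t hac hct => by
    have := eq_of_hasDeltaDerivWithin_zero (g := fun s => G c s * F a s) hct fun s hs =>
      (hG c s hs).adjoint_mul (hreg s)
        ((hF a s (hac.trans hs)).mono (Set.Ici_subset_Ici.2 hac)) hs
    simpa [hG1] using this
  have hGF : ∀ a t, a ≤ t → G a t * F a t = 1 := fun a t h => by
    rw [hGF' a a t le_rfl h, hF1]
  -- Only the left-inverse identity comes from differentiation; Dedekind finiteness gives the other
  -- side.
  have hFG : ∀ a t, a ≤ t → F a t * G a t = 1 := fun a t h => mul_eq_one_symm (hGF a t h)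
  have hFF : ∀ a c t, a ≤ c → c ≤ t → F a t = F c t * F a c := fun a c t hac hct => by
    rw [← hGF' a c t hac hct, ← mul_assoc, hFG c t hct, one_mul]
  have hGG : ∀ a c t, a ≤ c → c ≤ t → G a t = G a c * G c t := fun a c t hac hct => by
    have h1 : F c t = F a t * G a c := by
      rw [hFF a c t hac hct, mul_assoc, hFG a c hac, mul_one]
    rw [← mul_one (G a t), ← hFG c t hct, h1, ← mul_assoc, ← mul_assoc,
      hGF a t (hac.trans hct), one_mul]
  set X : T → 𝔸 := fun t => F (min t t₀) t * G (min t t₀) t₀ with hX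
  set Y : T → 𝔸 := fun t => F (min t t₀) t₀ * G (min t t₀) t with hY
  -- The base point `min s t₀` varies with `s`; the cocycle identities replace it by any fixed lower
  -- `c`, after which differentiation is immediate.
  have hXc : ∀ c, c ≤ t₀ → ∀ s, c ≤ s → X s = F c s * G c t₀ := fun c hc s hs => by
    have hm : c ≤ min s t₀ := le_min hs hc
    rw [hFF c _ s hm (min_le_left _ _), hGG c _ t₀ hm (min_le_right _ _), mul_assoc,
      ← mul_assoc (F c _), hFG c _ hm, one_mul]
  have hYc : ∀ c, c ≤ t₀ → ∀ s, c ≤ s → Y s = F c t₀ * G c s := fun c hc s hs => by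
    have hm : c ≤ min s t₀ := le_min hs hc
    rw [hGG c _ s hm (min_le_left _ _), hFF c _ t₀ hm (min_le_right _ _), mul_assoc,
      ← mul_assoc (F c _), hFG c _ hm, one_mul]
  refine ⟨X, Y, ?_, fun t => ?_, fun t => ?_, fun t => ?_⟩
  · simp [hX, hF1, hG1]
  · simp only [hX, hY]
    rw [mul_assoc, ← mul_assoc (G _ t), hGF _ t (min_le_left _ _), one_mul,
      hFG _ _ (min_le_right _ _)]
  · obtain ⟨c, hc₀, hct, hc⟩ := exists_le_and_Ici_mem_nhds t₀ t
    refine HasDeltaDerivWithin.of_mem_nhds ?_ hc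
    rw [hXc c hc₀ t hct, ← mul_assoc]
    exact ((hF c t hct).clm_comp ((ContinuousLinearMap.mul ℝ 𝔸).flip (G c t₀))).congr_Ici hct
      (hXc c hc₀)
  · obtain ⟨c, hc₀, hct, hc⟩ := exists_le_and_Ici_mem_nhds t₀ t
    refine HasDeltaDerivWithin.of_mem_nhds ?_ hc
    rw [hYc c hc₀ t hct, mul_assoc, ← mul_neg]
    exact ((hG c t hct).clm_comp (ContinuousLinearMap.mul ℝ 𝔸 (F c t₀))).congr_Ici hct
      (hYc c hc₀)

end

/-! ### Matrix functions: the transition matrix and the Lyapunov equation. -/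

section MatrixValued

open scoped Matrix.Norms.Operator

variable {T : TimeScale} {n : ℕ} {A M X P : T → Matrix (Fin n) (Fin n) ℝ}

theorem hasMatrixDeltaDeriv_iff {D : Matrix (Fin n) (Fin n) ℝ} {t : T} :
    HasMatrixDeltaDeriv X D t ↔ HasDeltaDerivWithin X D Set.univ t := by
  simp only [HasMatrixDeltaDeriv, hasDeltaDeriv_iff]
  constructor
  · intro h
    have h1 := HasDeltaDerivWithin.sum Finset.univ fun i _ =>
      HasDeltaDerivWithin.sum Finset.univ fun j _ => (h i j).clm_comp
        (LinearMap.toContinuousLinearMap (Matrix.singleLinearMap ℝ i j))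
    simpa [← Matrix.matrix_eq_sum_single] using h1
  · intro h i j
    exact h.clm_comp (LinearMap.toContinuousLinearMap (Matrix.entryLinearMap ℝ ℝ i j))

theorem HasDeltaDerivWithin.transpose {D : Matrix (Fin n) (Fin n) ℝ} {t : T}
    (h : HasDeltaDerivWithin X D Set.univ t) :
    HasDeltaDerivWithin (fun s => (X s).transpose) D.transpose Set.univ t :=
  hasMatrixDeltaDeriv_iff.1 fun i j => hasMatrixDeltaDeriv_iff.2 h j i

theorem MatrixRdContinuous.isRdContinuous (h : MatrixRdContinuous X) : IsRdContinuous X := by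
  have h1 : IsRdContinuous fun t => ∑ i, ∑ j, Matrix.single i j (X t i j) :=
    isRdContinuous_finset_sum _ fun i _ => isRdContinuous_finset_sum _ fun j _ =>
      IsRdContinuous.comp (h i j)
        (Matrix.singleLinearMap (α := ℝ) ℝ i j).continuous_of_finiteDimensional
  simpa only [← Matrix.matrix_eq_sum_single] using h1

theorem IsRdContinuous.matrix_elem (h : IsRdContinuous X) (i j : Fin n) :
    IsRdContinuous fun t => X t i j :=
  h.comp (LinearMap.toContinuousLinearMap (Matrix.entryLinearMap ℝ ℝ i j)).continuous

theorem MatrixRegressive.isUnit (h : MatrixRegressive A) (t : T) :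
    IsUnit (1 + graininess t • A t) := by
  by_cases ht : t ∈ kappa T
  · exact h.2 t ht
  · rw [graininess_eq_zero (sigma_eq_of_notMem_kappa ht), zero_smul, add_zero]
    exact isUnit_one

theorem solvesMatrixIVP_iff {t₀ : T} : SolvesMatrixIVP A t₀ X ↔
    (∀ t, HasDeltaDerivWithin X (A t * X t) Set.univ t) ∧ X t₀ = 1 := by
  refine and_congr_left' ⟨fun h t => ?_, fun h t _ => hasMatrixDeltaDeriv_iff.2 (h t)⟩
  by_cases ht : t ∈ kappa T
  · exact hasMatrixDeltaDeriv_iff.1 (h t ht)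
  · exact hasDeltaDerivWithin_of_notMem_kappa ht _ _ _

/-- Existence and uniqueness of the transition matrix, with its inverse. -/
theorem exists_transitionMatrix_inv (hA : MatrixRegressive A) (t₀ : T) :
    SolvesMatrixIVP A t₀ (transitionMatrix A t₀) ∧
      (∀ X, SolvesMatrixIVP A t₀ X → X = transitionMatrix A t₀) ∧
      ∃ Y : T → Matrix (Fin n) (Fin n) ℝ, (∀ t, Y t * transitionMatrix A t₀ t = 1) ∧
        ∀ t, HasDeltaDerivWithin Y (-(Y t * (A t * regressiveInv A t))) Set.univ t := by
  obtain ⟨X, Y, hX₀, hYX, hX, hY⟩ := exists_transition_pair hA.1.isRdContinuous hA.isUnit t₀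
  have hYt₀ : Y t₀ = 1 := by simpa [hX₀] using hYX t₀
  have huniq : ∀ Z, SolvesMatrixIVP A t₀ Z → Z = X := fun Z hZ => by
    obtain ⟨hZ, hZ₀⟩ := solvesMatrixIVP_iff.1 hZ
    funext t
    -- The inverse `Y` of one solution, multiplied by any other solution, is constant.
    have h1 : Y t * Z t = Y t₀ * Z t₀ :=
      eq_of_hasDeltaDerivWithin_univ_zero (g := fun s => Y s * Z s)
        (fun s => (hY s).adjoint_mul (hA.isUnit s) (hZ s) (Set.mem_univ s)) t t₀
    rw [← one_mul (Z t), ← mul_eq_one_symm (hYX t), mul_assoc, h1, hZ₀, hYt₀, one_mul, mul_one]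
  have hsolX : SolvesMatrixIVP A t₀ X := solvesMatrixIVP_iff.2 ⟨hX, hX₀⟩
  have hsol : SolvesMatrixIVP A t₀ (transitionMatrix A t₀) := Classical.epsilon_spec ⟨X, hsolX⟩
  have heq := huniq _ hsol
  exact ⟨hsol, fun Z hZ => (huniq Z hZ).trans heq.symm, Y, heq ▸ hYX, hY⟩

theorem hasDeltaDerivWithin_matrixDeltaIntegral (hX : IsRdContinuous X) (a t : T) :
    HasDeltaDerivWithin (matrixDeltaIntegral X a) (X t) Set.univ t :=
  hasMatrixDeltaDeriv_iff.1 fun i j =>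
    hasDeltaDeriv_iff.2 (hasDeltaDeriv_deltaIntegral (hX.matrix_elem i j) a t)

theorem matrixDeltaIntegral_self (X : T → Matrix (Fin n) (Fin n) ℝ) (a : T) :
    matrixDeltaIntegral X a a = 0 := by
  ext i j
  simp [matrixDeltaIntegral, deltaIntegral]

/-- Conjugating a solution of the dynamic Lyapunov equation by the transition matrix integrates
the equation. -/
theorem HasDeltaDerivWithin.transpose_mul_mul {D : Matrix (Fin n) (Fin n) ℝ} {t : T}
    (hX : HasDeltaDerivWithin X (A t * X t) Set.univ t)
    (hP : HasDeltaDerivWithin P D Set.univ t)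
    (h : (A t).transpose * P t + P t * A t + graininess t • ((A t).transpose * P t * A t)
      + (1 + graininess t • (A t).transpose) * D * (1 + graininess t • A t) = -M t) :
    HasDeltaDerivWithin (fun s => (X s).transpose * P s * X s)
      (-((X t).transpose * M t * X t)) Set.univ t := by
  have h1 := (hX.transpose.mul hP (Set.mem_univ t)).mul hX (Set.mem_univ t)
  have hσ := hX.apply_sigma (Set.mem_univ t)
  have hPσ := hP.apply_sigma (Set.mem_univ t)
  refine h1.congr_deriv ?_
  have hM' : M t = -((A t).transpose * P t + P t * A t +
      graininess t • ((A t).transpose * P t * A t)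
      + (1 + graininess t • (A t).transpose) * D * (1 + graininess t • A t)) := by
    rw [h, neg_neg]
  rw [hM', hσ, hPσ]
  simp only [Matrix.transpose_add, Matrix.transpose_mul, Matrix.transpose_smul, mul_add, add_mul,
    smul_mul_assoc, mul_smul_comm, mul_one, one_mul, mul_neg, neg_mul, neg_neg, smul_add,
    mul_assoc]
  abel

theorem isRdContinuous_transpose_mul_mul
    (hX : ∀ t, HasDeltaDerivWithin X (A t * X t) Set.univ t) (hM : MatrixRdContinuous M) :
    IsRdContinuous fun t => (X t).transpose * M t * X t :=
  ((continuous_of_hasDeltaDerivWithin_univ fun t => (hX t).transpose).isRdContinuous.mul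
    hM.isRdContinuous).mul (continuous_of_hasDeltaDerivWithin_univ hX).isRdContinuous

theorem hasDeltaDerivWithin_sub_matrixDeltaIntegral (hX : IsRdContinuous X)
    (P₀ : Matrix (Fin n) (Fin n) ℝ) (a t : T) :
    HasDeltaDerivWithin (fun t => P₀ - matrixDeltaIntegral X a t) (-X t) Set.univ t := by
  have h := (hasDeltaDerivWithin_const P₀ Set.univ t).sub
    (hasDeltaDerivWithin_matrixDeltaIntegral hX a t)
  rwa [zero_sub] at h

/-- A solution of the dynamic Lyapunov equation, conjugated by the transition matrix, is
determined by its delta derivative and its initial value. -/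
theorem eq_of_solvesDynamicLyapunov {R : T → Matrix (Fin n) (Fin n) ℝ} {t₀ : T}
    {P₀ : Matrix (Fin n) (Fin n) ℝ} (hX : ∀ t, HasDeltaDerivWithin X (A t * X t) Set.univ t)
    (hX₀ : X t₀ = 1) (hP : SolvesDynamicLyapunov A M t₀ P₀ P)
    (hR : ∀ t, HasDeltaDerivWithin R (-((X t).transpose * M t * X t)) Set.univ t)
    (hR₀ : R t₀ = P₀) (t : T) : (X t).transpose * P t * X t = R t := by
  have hd : ∀ s, HasDeltaDerivWithin (fun s => (X s).transpose * P s * X s - R s) 0 Set.univ s := by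
    intro s
    by_cases hs : s ∈ kappa T
    · obtain ⟨D, hD, h⟩ := hP.1 s hs
      have h1 := ((hX s).transpose_mul_mul (hasMatrixDeltaDeriv_iff.1 hD) h).sub (hR s)
      rwa [sub_self] at h1
    · exact hasDeltaDerivWithin_of_notMem_kappa hs _ _ _
  have h := eq_of_hasDeltaDerivWithin_univ_zero hd t t₀
  rw [hX₀, hP.2, hR₀, Matrix.transpose_one, one_mul, mul_one, sub_self] at h
  exact sub_eq_zero.1 h

/-- The conjugate `Yᵀ R Y` solves the dynamic Lyapunov equation when `Y` is the inverse of the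
transition matrix `X` and `R` has derivative `-Xᵀ M X`. -/
theorem exists_hasDeltaDerivWithin_lyapunov {Y R : T → Matrix (Fin n) (Fin n) ℝ} {t : T}
    (hA : IsUnit (1 + graininess t • A t)) (hYX : Y t * X t = 1)
    (hY : HasDeltaDerivWithin Y (-(Y t * (A t * regressiveInv A t))) Set.univ t)
    (hR : HasDeltaDerivWithin R (-((X t).transpose * M t * X t)) Set.univ t) :
    ∃ D, HasDeltaDerivWithin (fun s => (Y s).transpose * R s * Y s) D Set.univ t ∧
      (A t).transpose * ((Y t).transpose * R t * Y t) + (Y t).transpose * R t * Y t * A t +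
        graininess t • ((A t).transpose * ((Y t).transpose * R t * Y t) * A t) +
        (1 + graininess t • (A t).transpose) * D * (1 + graininess t • A t) = -M t := by
  have hYσ := hY.apply_sigma_eq_mul_regressiveInv hA (Set.mem_univ t)
  refine ⟨_, (hY.transpose.mul hR (Set.mem_univ t)).mul hY (Set.mem_univ t), ?_⟩
  have hXY : X t * Y t = 1 := mul_eq_one_symm hYX
  have hYXT : (Y t).transpose * (X t).transpose = 1 := by
    rw [← Matrix.transpose_mul, hXY, Matrix.transpose_one]
  have hRσ := hR.apply_sigma (Set.mem_univ t)
  have hN := regressiveInv_mul hA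
  have hcomm := mul_regressiveInv_comm hA
  have hBT : (1 + graininess t • (A t).transpose) = (1 + graininess t • A t).transpose := by
    simp
  have hNT : (1 + graininess t • (A t).transpose) * (regressiveInv A t).transpose = 1 := by
    rw [hBT, ← Matrix.transpose_mul, hN, Matrix.transpose_one]
  rw [hYσ, hRσ, hcomm]
  simp only [Matrix.transpose_neg, Matrix.transpose_mul]
  -- Commutation is used to bring the transposed inverse to the left, where it meets and cancels `1
  -- + μAᵀ`.
  rw [← Matrix.transpose_mul (regressiveInv A t) (A t), ← hcomm,
    Matrix.transpose_mul (A t) (regressiveInv A t)]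
  set B := 1 + graininess t • A t with hB
  set C := 1 + graininess t • (A t).transpose with hC
  set N := regressiveInv A t with hNdef
  set Q := (Y t).transpose * R t * Y t with hQ
  have hAN : A t * N * B = A t := by rw [mul_assoc, hN, mul_one]
  have hCN : C * (N.transpose * (A t).transpose) = (A t).transpose := by
    rw [← mul_assoc, hNT, one_mul]
  have e1 : (Y t).transpose * ((X t).transpose * M t * X t) * Y t = M t := by
    rw [mul_assoc (X t).transpose, ← mul_assoc (Y t).transpose, hYXT, one_mul, mul_assoc, hXY,
      mul_one]
  set K := (X t).transpose * M t * X t with hK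
  -- Regrouped so that every factor sits in a block that `e1`, `hCN`, `hNT` or `hAN` simplifies.
  have e2 : C * ((-(N.transpose * (A t).transpose * (Y t).transpose) * R t +
      N.transpose * (Y t).transpose * -K) * Y t +
      N.transpose * (Y t).transpose * (R t + graininess t • -K) * -(Y t * (A t * N))) * B =
      -(C * (N.transpose * (A t).transpose)) * Q * B -
      C * N.transpose * ((Y t).transpose * K * Y t) * B -
      C * N.transpose * (Q - graininess t • ((Y t).transpose * K * Y t)) * (A t * N * B) := by
    simp only [hQ, mul_add, add_mul, mul_sub, sub_mul, mul_neg, neg_mul, smul_neg, mul_smul_comm,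
      smul_mul_assoc, mul_assoc]
    abel
  rw [e2, e1, hCN, hNT, hAN, hB]
  simp only [mul_add, sub_mul, one_mul, mul_one, mul_smul_comm, smul_mul_assoc, neg_mul, smul_neg,
    mul_assoc]
  abel

end MatrixValued

end TimeScale

end

/-! ### The closed form and its uniqueness. -/

open TimeScale

theorem mainTheorem1 (T : TimeScale) (n : ℕ) (A M : T → Matrix (Fin n) (Fin n) ℝ)
    (hA : TimeScale.MatrixRegressive A) (hM : TimeScale.MatrixRdContinuous M)
    (t₀ : T) (P₀ : Matrix (Fin n) (Fin n) ℝ) :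
    -- the transition matrix is the unique solution of its initial value problem, and is invertible
    (TimeScale.SolvesMatrixIVP A t₀ (TimeScale.transitionMatrix A t₀) ∧
      (∀ X : T → Matrix (Fin n) (Fin n) ℝ, TimeScale.SolvesMatrixIVP A t₀ X →
        X = TimeScale.transitionMatrix A t₀) ∧
      ∀ t : T, IsUnit (TimeScale.transitionMatrix A t₀ t)) ∧
    -- the integrand of the closed form is delta integrable on bounded intervals
    (∀ a b : T, ∀ i j : Fin n,
      IntegrableOn
        (fun s : T => ((TimeScale.transitionMatrix A t₀ s).transpose * M s *
          TimeScale.transitionMatrix A t₀ s) i j)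
        (Set.Ico a b) (TimeScale.deltaMeasure T)) ∧
    -- the dynamic Lyapunov equation has exactly one solution
    (∃! P : T → Matrix (Fin n) (Fin n) ℝ, TimeScale.SolvesDynamicLyapunov A M t₀ P₀ P) ∧
    -- and the closed form is that solution
    TimeScale.SolvesDynamicLyapunov A M t₀ P₀ (fun t : T =>
      ((TimeScale.transitionMatrix A t₀ t).transpose)⁻¹ *
        (P₀ - TimeScale.matrixDeltaIntegral
          (fun s : T => (TimeScale.transitionMatrix A t₀ s).transpose * M s *
            TimeScale.transitionMatrix A t₀ s) t₀ t) *
        (TimeScale.transitionMatrix A t₀ t)⁻¹) := by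
  obtain ⟨hsol, huniq, Y, hYX, hY⟩ := exists_transitionMatrix_inv hA t₀
  set X := transitionMatrix A t₀ with hXdef
  obtain ⟨hX, hX₀⟩ := solvesMatrixIVP_iff.1 hsol
  have hXY : ∀ t, X t * Y t = 1 := fun t => mul_eq_one_symm (hYX t)
  have hYXT : ∀ t, (Y t).transpose * (X t).transpose = 1 := fun t => by
    rw [← Matrix.transpose_mul, hXY, Matrix.transpose_one]
  have hY₀ : Y t₀ = 1 := by simpa [hX₀] using hYX t₀
  have hinv : ∀ t, (X t)⁻¹ = Y t := fun t => Matrix.inv_eq_left_inv (hYX t)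
  have hinvT : ∀ t, (X t).transpose⁻¹ = (Y t).transpose := fun t =>
    Matrix.inv_eq_left_inv (hYXT t)
  have hrd := isRdContinuous_transpose_mul_mul hX hM
  set K : T → Matrix (Fin n) (Fin n) ℝ := fun s => (X s).transpose * M s * X s with hK
  set R : T → Matrix (Fin n) (Fin n) ℝ := fun t => P₀ - matrixDeltaIntegral K t₀ t with hRdef
  have hR := fun t =>
    hasDeltaDerivWithin_sub_matrixDeltaIntegral hrd P₀ t₀ t
  have hR₀ : R t₀ = P₀ := by simp [hRdef, matrixDeltaIntegral_self]
  simp only [hinv, hinvT]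
  have hP : SolvesDynamicLyapunov A M t₀ P₀ fun t => (Y t).transpose * R t * Y t := by
    refine ⟨fun t _ => ?_, by simp [hY₀, hR₀]⟩
    obtain ⟨D, hD, h⟩ := exists_hasDeltaDerivWithin_lyapunov (hA.isUnit t) (hYX t) (hY t) (hR t)
    exact ⟨D, hasMatrixDeltaDeriv_iff.2 hD, h⟩
  refine ⟨⟨hsol, huniq, fun t => .of_mul_eq_one (Y t) (hXY t)⟩, fun a b i j =>
    (hrd.matrix_elem i j).integrableOn a b, ⟨_, hP, fun P hP' => ?_⟩, hP⟩
  funext t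
  have hQR : (X t).transpose * P t * X t = R t :=
    eq_of_solvesDynamicLyapunov hX hX₀ hP' hR hR₀ t
  calc P t = (Y t).transpose * (X t).transpose * P t * (X t * Y t) := by
        rw [hYXT, hXY, one_mul, mul_one]
    _ = (Y t).transpose * ((X t).transpose * P t * X t) * Y t := by simp only [mul_assoc]
    _ = _ := by rw [hQR]
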